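/- Let $R$ be a Prüfer domain (an integral domain in which every nonzero finitely generated ideal is invertible) with quotient field $K$. A semistar operation on $R$ is a map $\star\colon I\mapsto I^\star$ from the set of all $R$-submodules of $K$ to itself such that, for all $R$-submodules $I,J$ of $K$ and all $x\in K$: $I\subseteq I^\star$; $(I^\star)^\star=I^\star$; $I\subseteq J$ implies $I^\star\subseteq J^\star$; and $(xI)^\star=x\cdot I^\star$. It is called stable if $(I\cap J)^\star=I^\star\cap J^\star$ for all $R$-submodules $I,J$ of $K$, and spectral if there is a set $\Delta\subseteq\operatorname{Spec}(R)$ such that $I^\star=\bigcap_{P\in\Delta}IR_P$ for every $R$-submodule $I$ of $K$. Suppose that $\operatorname{Spec}(R)$ is a Noetherian topological space and that, for every prime ideal $P$ of $R$, the ideal $PR_P$ of $R_P$ is principal. Then every stable semistar operation on $R$ is spectral. -/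

import Mathlib

open scoped Pointwise nonZeroDivisors

/-- A Prüfer domain: an integral domain in which every nonzero finitely generated ideal is
invertible (as a fractional ideal). -/
def IsPruferDomain (R : Type*) [CommRing R] [IsDomain R] : Prop :=
  ∀ I : Ideal R, I ≠ ⊥ → I.FG → IsUnit (I : FractionalIdeal R⁰ (FractionRing R))

/-- A semistar operation on the domain `R` with quotient field `K`: a map on the set of all
`R`-submodules of `K` which is extensive, idempotent, monotone and compatible with
multiplication by elements of `K`. -/
structure SemistarOperation (R K : Type*) [CommRing R] [Field K] [Algebra R K] where
  /-- the map `I ↦ I^⋆` -/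
  star : Submodule R K → Submodule R K
  le_star : ∀ I, I ≤ star I
  star_star : ∀ I, star (star I) = star I
  star_mono : ∀ I J, I ≤ J → star I ≤ star J
  star_smul : ∀ (x : K) (I), star (x • I) = x • star I

/-- The `R`-submodule `I R_P` of `K`: the product of `I` with the localization `R_P`, viewed
inside the quotient field `K`. -/
noncomputable def localizeAt {R K : Type*} [CommRing R] [IsDomain R] [Field K] [Algebra R K]
    [IsFractionRing R K] (I : Submodule R K) (P : PrimeSpectrum R) : Submodule R K :=
  I * Subalgebra.toSubmodule
    (Localization.subalgebra.ofField K P.asIdeal.primeCompl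
      P.asIdeal.primeCompl_le_nonZeroDivisors)

namespace SemistarOperation

/-- A semistar operation is stable if it commutes with finite intersections. -/
def IsStable {R K : Type*} [CommRing R] [Field K] [Algebra R K]
    (s : SemistarOperation R K) : Prop :=
  ∀ I J : Submodule R K, s.star (I ⊓ J) = s.star I ⊓ s.star J

/-- A semistar operation is spectral if it is of the form `I ↦ ⋂_{P ∈ Δ} I R_P` for some set `Δ`
of prime ideals of `R`. -/
def IsSpectral {R K : Type*} [CommRing R] [IsDomain R] [Field K] [Algebra R K]
    [IsFractionRing R K] (s : SemistarOperation R K) : Prop :=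
  ∃ Δ : Set (PrimeSpectrum R), ∀ I : Submodule R K, s.star I = ⨅ P ∈ Δ, localizeAt I P

end SemistarOperation

open TopologicalSpace

/-! By stability, `x ∈ I^⋆` iff `(I : x)` lies in the set F of ideals whose closure contains 1,
while `x ∈ I R_P` iff `(I : x)` is not inside `P`. Take Δ to be the primes outside F. As F is closed
upward, only one direction is at stake: an ideal contained in no prime of Δ must lie in F. Its
minimal primes are then in F. They are finitely many, and the ideal contains a product of their
powers (`exists_prod_pow_minimalPrimes_le`), so closure of F under products finishes. -/

theorem PrimeSpectrum.finite_minimalPrimes {R : Type*} [CommRing R]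
    [NoetherianSpace (PrimeSpectrum R)] (I : Ideal R) : I.minimalPrimes.Finite := by
  obtain ⟨S, hSf, -, hSi, hSU⟩ := NoetherianSpace.exists_finite_set_isClosed_irreducible
    (PrimeSpectrum.isClosed_zeroLocus (I : Set R))
  refine (hSf.image PrimeSpectrum.vanishingIdeal).subset fun P hP => ?_
  have hmem : (⟨P, hP.1.1⟩ : PrimeSpectrum R) ∈ ⋃₀ S := hSU ▸ hP.1.2
  obtain ⟨Z, hZ, hPZ⟩ := hmem
  have hle : PrimeSpectrum.vanishingIdeal Z ≤ P := fun r hr =>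
    (PrimeSpectrum.mem_vanishingIdeal Z r).1 hr _ hPZ
  have hI : I ≤ PrimeSpectrum.vanishingIdeal Z := by
    rw [← PrimeSpectrum.subset_zeroLocus_iff_le_vanishingIdeal, hSU]
    exact Set.subset_sUnion_of_mem hZ
  have hprime := PrimeSpectrum.isIrreducible_iff_vanishingIdeal_isPrime.1 (hSi Z hZ)
  exact ⟨Z, hZ, le_antisymm hle (hP.2 ⟨hprime, hI⟩ hle)⟩

/-- In a Prüfer domain, divisibility is total locally at every prime. -/
theorem IsPruferDomain.exists_notMem_dvd {R : Type*} [CommRing R] [IsDomain R]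
    (hR : IsPruferDomain R) (M : Ideal R) [M.IsPrime] (a b : R) :
    ∃ s ∉ M, a ∣ s * b ∨ b ∣ s * a := by
  by_cases h0 : Ideal.span {a, b} = ⊥
  · have ha : a = 0 := by
      have : a ∈ Ideal.span {a, b} := Ideal.subset_span (by simp)
      simpa [h0] using this
    exact ⟨1, M.one_notMem, Or.inr (by simp [ha])⟩
  obtain ⟨u, hu⟩ := hR _ h0 (Submodule.fg_span (by simp))
  let f := algebraMap R (FractionRing R)
  have hmem {c : R} (hc : c ∈ Ideal.span {a, b}) {y : FractionRing R}
      (hy : y ∈ (↑u⁻¹ : FractionalIdeal R⁰ (FractionRing R))) : ∃ r : R, f r = f c * y := by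
    have hcy : f c * y ∈ (u : FractionalIdeal R⁰ (FractionRing R)) * ↑u⁻¹ :=
      FractionalIdeal.mul_mem_mul (hu ▸ FractionalIdeal.mem_coeIdeal_of_mem _ hc) hy
    rw [Units.mul_inv, FractionalIdeal.mem_one_iff] at hcy
    exact hcy
  have ha : a ∈ Ideal.span {a, b} := Ideal.subset_span (by simp)
  have hb : b ∈ Ideal.span {a, b} := Ideal.subset_span (by simp)
  have hinj : Function.Injective f := IsFractionRing.injective R (FractionRing R)
  -- Otherwise every product of an element of `(a, b)` with one of its inverse lies in `M`, yet sums
  -- of such products give 1.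
  by_contra! hcon
  have hsM {c : R} (hc : c ∈ Ideal.span {a, b}) {y : FractionRing R}
      (hy : y ∈ (↑u⁻¹ : FractionalIdeal R⁰ (FractionRing R))) {r : R} (hr : f r = f c * y) :
      r ∈ M := by
    have aux {c r : R} {y : FractionRing R}
        (hy : y ∈ (↑u⁻¹ : FractionalIdeal R⁰ (FractionRing R))) (hr : f r = f c * y)
        {d : R} (hd : d ∈ Ideal.span {a, b}) : c ∣ r * d := by
      obtain ⟨t, ht⟩ := hmem hd hy
      refine ⟨t, hinj ?_⟩
      rw [map_mul, map_mul, hr, ht]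
      ring
    obtain ⟨p, q, rfl⟩ := Ideal.mem_span_pair.1 hc
    obtain ⟨r₁, h₁⟩ := hmem ha hy
    obtain ⟨r₂, h₂⟩ := hmem hb hy
    have hr' : r = p * r₁ + q * r₂ := by
      apply hinj
      simp only [hr, map_add, map_mul, h₁, h₂]
      ring
    have h₁M : r₁ ∈ M := by
      by_contra h
      exact (hcon r₁ h).1 (aux hy h₁ hb)
    have h₂M : r₂ ∈ M := by
      by_contra h
      exact (hcon r₂ h).2 (aux hy h₂ ha)
    rw [hr']
    exact M.add_mem (M.mul_mem_left _ h₁M) (M.mul_mem_left _ h₂M)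
  have hone : (1 : FractionRing R) ∈ (u : FractionalIdeal R⁰ (FractionRing R)) * ↑u⁻¹ := by
    rw [Units.mul_inv]
    exact FractionalIdeal.one_mem_one R⁰
  have hall : ∀ z ∈ (u : FractionalIdeal R⁰ (FractionRing R)) * ↑u⁻¹, ∃ r ∈ M, f r = z := by
    intro z hz
    refine FractionalIdeal.mul_induction_on hz (fun i hi j hj => ?_) fun x y hx hy => ?_
    · rw [hu, FractionalIdeal.mem_coeIdeal] at hi
      obtain ⟨c, hc, rfl⟩ := hi
      obtain ⟨r, hr⟩ := hmem hc hj
      exact ⟨r, hsM hc hj hr, hr⟩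
    · obtain ⟨r, hr, rfl⟩ := hx
      obtain ⟨t, ht, rfl⟩ := hy
      exact ⟨r + t, M.add_mem hr ht, map_add f r t⟩
  obtain ⟨r, hr, h⟩ := hall 1 hone
  rw [← map_one f] at h
  exact M.one_notMem (hinj h ▸ hr)

/-- The radical of `I R_P` is `P R_P`; being finitely generated, it has a power inside `I R_P`. -/
theorem Ideal.exists_pow_locally_le_of_mem_minimalPrimes {R : Type*} [CommRing R] {I P : Ideal R}
    [P.IsPrime] (hP : P ∈ I.minimalPrimes)
    (hprinc : (P.map (algebraMap R (Localization.AtPrime P))).IsPrincipal) :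
    ∃ n : ℕ, ∀ x ∈ P ^ n, ∃ s ∉ P, s * x ∈ I := by
  have hrad := IsLocalization.AtPrime.radical_map_of_mem_minimalPrimes
    (A := Localization.AtPrime P) P I hP
  obtain ⟨n, hn⟩ := Ideal.exists_radical_pow_le_of_fg
    (I.map (algebraMap R (Localization.AtPrime P))) (hrad ▸ hprinc.fg)
  rw [hrad, ← Ideal.map_pow] at hn
  refine ⟨n, fun x hx => ?_⟩
  exact (IsLocalization.algebraMap_mem_map_algebraMap_iff P.primeCompl _ I x).1
    (hn (Ideal.mem_map_of_mem _ hx))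

/-- One extra factor of `P` passes from `R_P` to `R_M`: in the valuation ring `R_M`, each `p ∈ P` is
divisible by any denominator `t ∉ P`. Hence one exponent serves all `M`. -/
theorem IsPruferDomain.exists_pow_locally_le {R : Type*} [CommRing R] [IsDomain R]
    (hR : IsPruferDomain R) {I P : Ideal R} [P.IsPrime] (hP : P ∈ I.minimalPrimes)
    (hprinc : (P.map (algebraMap R (Localization.AtPrime P))).IsPrincipal) :
    ∃ n : ℕ, ∀ M : Ideal R, M.IsPrime → P ≤ M → ∀ x ∈ P ^ n, ∃ s ∉ M, s * x ∈ I := by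
  obtain ⟨n, hn⟩ := Ideal.exists_pow_locally_le_of_mem_minimalPrimes hP hprinc
  refine ⟨n + 1, fun M hM hPM x hx => ?_⟩
  rw [pow_succ] at hx
  induction hx using Submodule.mul_induction_on' with
  | mem_mul_mem y hy p hp =>
    obtain ⟨t, htP, ht⟩ := hn y hy
    obtain ⟨s, hsM, ⟨c, hc⟩ | ⟨c, hc⟩⟩ := hR.exists_notMem_dvd M t p
    · refine ⟨s, hsM, ?_⟩
      have : s * (y * p) = c * (t * y) := by
        linear_combination y * hc
      exact this ▸ I.mul_mem_left c ht
    · have : s * t ∈ P := hc ▸ P.mul_mem_right c hp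
      exact absurd this fun h => (Ideal.IsPrime.mem_or_mem ‹P.IsPrime› h).elim
        (fun h => hsM (hPM h)) htP
  | add x _ y _ hx hy =>
    obtain ⟨s, hs, hsx⟩ := hx
    obtain ⟨t, ht, hty⟩ := hy
    refine ⟨s * t, fun h => (hM.mem_or_mem h).elim hs ht, ?_⟩
    have : s * t * (x + y) = t * (s * x) + s * (t * y) := by ring
    exact this ▸ I.add_mem (I.mul_mem_left _ hsx) (I.mul_mem_left _ hty)

theorem Ideal.mem_of_locally_mem {R : Type*} [CommRing R] {I : Ideal R} {x : R}
    (h : ∀ M : Ideal R, M.IsPrime → I ≤ M → ∃ s ∉ M, s * x ∈ I) : x ∈ I := by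
  by_contra hx
  have hne : Submodule.comap (LinearMap.mulRight R x) I ≠ ⊤ := fun htop => hx <| by
    have : (1 : R) ∈ Submodule.comap (LinearMap.mulRight R x) I := htop ▸ Submodule.mem_top
    simpa using this
  obtain ⟨M, hM, hle⟩ := Ideal.exists_le_maximal _ hne
  obtain ⟨s, hs, hsx⟩ := h M hM.isPrime
    fun r hr => hle (Submodule.mem_comap.2 (I.mul_mem_right x hr))
  exact hs (hle (Submodule.mem_comap.2 hsx))

/-- Every ideal contains a product of powers of its minimal primes. -/
theorem IsPruferDomain.exists_prod_pow_minimalPrimes_le {R : Type*} [CommRing R] [IsDomain R]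
    (hR : IsPruferDomain R) [NoetherianSpace (PrimeSpectrum R)]
    (hprinc : ∀ P : PrimeSpectrum R,
      (P.asIdeal.map (algebraMap R (Localization.AtPrime P.asIdeal))).IsPrincipal)
    (I : Ideal R) :
    ∃ n : Ideal R → ℕ,
      ∏ P ∈ (PrimeSpectrum.finite_minimalPrimes I).toFinset, P ^ n P ≤ I := by
  have h : ∀ P : Ideal R, ∃ n : ℕ, P ∈ I.minimalPrimes →
      ∀ M : Ideal R, M.IsPrime → P ≤ M → ∀ x ∈ P ^ n, ∃ s ∉ M, s * x ∈ I := by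
    intro P
    by_cases hP : P ∈ I.minimalPrimes
    · have := hP.1.1
      obtain ⟨n, hn⟩ := hR.exists_pow_locally_le hP (hprinc ⟨P, hP.1.1⟩)
      exact ⟨n, fun _ => hn⟩
    · exact ⟨0, fun h => absurd h hP⟩
  choose n hn using h
  refine ⟨n, fun x hx => Ideal.mem_of_locally_mem fun M hM hIM => ?_⟩
  obtain ⟨P, hP, hPM⟩ := Ideal.exists_minimalPrimes_le hIM
  exact hn P hP M hM hPM x (Ideal.le_of_dvd
    (Finset.dvd_prod_of_mem (fun P => P ^ n P)
      ((PrimeSpectrum.finite_minimalPrimes I).mem_toFinset.2 hP)) hx)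

/-! ### Membership in `I R_P` through conductors -/

section Localize

variable {R K : Type*} [CommRing R] [Field K] [Algebra R K]

/-- The ideal `(I : x)` of elements of `R` multiplying `x` into `I`. -/
def conductorIdeal (I : Submodule R K) (x : K) : Ideal R :=
  I.comap (LinearMap.toSpanSingleton R K x)

theorem mem_conductorIdeal {I : Submodule R K} {x : K} {r : R} :
    r ∈ conductorIdeal I x ↔ r • x ∈ I := Iff.rfl

theorem mem_localizeAt_iff [IsDomain R] [IsFractionRing R K] {I : Submodule R K}
    {P : PrimeSpectrum R} {x : K} :
    x ∈ localizeAt I P ↔ ¬ conductorIdeal I x ≤ P.asIdeal := by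
  have hmem (y : K) : y ∈ Subalgebra.toSubmodule (Localization.subalgebra.ofField K
      P.asIdeal.primeCompl P.asIdeal.primeCompl_le_nonZeroDivisors) ↔
      ∃ (a s : R) (_ : s ∈ P.asIdeal.primeCompl),
        y = algebraMap R K a * (algebraMap R K s)⁻¹ := Iff.rfl
  have hne {s : R} (hs : s ∉ P.asIdeal) : algebraMap R K s ≠ 0 := by
    rw [Ne, FaithfulSMul.algebraMap_eq_zero_iff]
    rintro rfl
    exact hs P.asIdeal.zero_mem
  rw [SetLike.not_le_iff_exists]
  constructor
  · intro hx
    induction hx using Submodule.mul_induction_on' with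
    | mem_mul_mem y hy z hz =>
      obtain ⟨a, s, hs, rfl⟩ := (hmem z).1 hz
      refine ⟨s, mem_conductorIdeal.2 ?_, hs⟩
      have : s • (y * (algebraMap R K a * (algebraMap R K s)⁻¹)) = a • y := by
        have := hne hs
        rw [Algebra.smul_def, Algebra.smul_def]
        field_simp
      exact this ▸ I.smul_mem a hy
    | add x _ y _ hx hy =>
      obtain ⟨s, hsx, hs⟩ := hx
      obtain ⟨t, hty, ht⟩ := hy
      refine ⟨s * t, mem_conductorIdeal.2 ?_, fun h => (P.2.mem_or_mem h).elim hs ht⟩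
      have : (s * t) • (x + y) = t • (s • x) + s • (t • y) := by
        rw [smul_add, mul_smul, mul_smul, smul_comm s t x]
      exact this ▸ I.add_mem (I.smul_mem _ hsx) (I.smul_mem _ hty)
  · rintro ⟨s, hsx, hs⟩
    have : x = (s • x) * (algebraMap R K 1 * (algebraMap R K s)⁻¹) := by
      have := hne hs
      rw [Algebra.smul_def, map_one]
      field_simp
    rw [this]
    exact Submodule.mul_mem_mul hsx ((hmem _).2 ⟨1, s, hs, rfl⟩)

end Localize

/-! ### The localizing system of a semistar operation -/

namespace SemistarOperation

open IsLocalization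

variable {R K : Type*} [CommRing R] [Field K] [Algebra R K] (s : SemistarOperation R K)

/-- The ideals `I` of `R` whose closure contains `1`; for a stable operation this is the
associated localizing system. -/
def localizingSystem : Set (Ideal R) :=
  {I | (1 : K) ∈ s.star (coeSubmodule K I)}

variable {s}

theorem top_mem_localizingSystem : (⊤ : Ideal R) ∈ s.localizingSystem :=
  s.le_star _ ⟨1, Submodule.mem_top, map_one (algebraMap R K)⟩

theorem mem_localizingSystem_of_le {I J : Ideal R} (hI : I ∈ s.localizingSystem) (h : I ≤ J) :
    J ∈ s.localizingSystem :=
  s.star_mono _ _ (coeSubmodule_mono K h) hI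

/-- For `a ∈ I`, `1 ∈ J^⋆` gives `a ∈ (aJ)^⋆ ⊆ (IJ)^⋆`; so `I ⊆ (IJ)^⋆`, and idempotence applies. -/
theorem mul_mem_localizingSystem {I J : Ideal R} (hI : I ∈ s.localizingSystem)
    (hJ : J ∈ s.localizingSystem) : I * J ∈ s.localizingSystem := by
  have h : coeSubmodule K I ≤ s.star (coeSubmodule K (I * J)) := by
    rintro _ ⟨a, ha, rfl⟩
    have hle : algebraMap R K a • coeSubmodule K J ≤ coeSubmodule K (I * J) := by
      rintro _ ⟨_, ⟨b, hb, rfl⟩, rfl⟩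
      exact ⟨a * b, Ideal.mul_mem_mul ha hb, map_mul (algebraMap R K) a b⟩
    apply s.star_mono _ _ hle
    rw [s.star_smul]
    simpa using Submodule.smul_mem_pointwise_smul (1 : K) (algebraMap R K a) _ hJ
  have := s.star_mono _ _ h hI
  rwa [s.star_star] at this

theorem prod_pow_mem_localizingSystem (S : Finset (Ideal R)) (n : Ideal R → ℕ)
    (h : ∀ P ∈ S, P ∈ s.localizingSystem) : ∏ P ∈ S, P ^ n P ∈ s.localizingSystem := by
  refine Finset.prod_induction _ (· ∈ s.localizingSystem) (fun _ _ => mul_mem_localizingSystem)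
    (Ideal.one_eq_top (R := R) ▸ top_mem_localizingSystem) fun P hP => ?_
  induction n P with
  | zero => simpa using top_mem_localizingSystem
  | succ k ih => exact pow_succ P k ▸ mul_mem_localizingSystem ih (h P hP)

/-- A stable semistar operation is determined by its localizing system. -/
theorem IsStable.mem_star_iff (hs : s.IsStable) {I : Submodule R K} {x : K} :
    x ∈ s.star I ↔ conductorIdeal I x ∈ s.localizingSystem := by
  rcases eq_or_ne x 0 with rfl | hx
  · have : conductorIdeal I (0 : K) = ⊤ := by
      ext r
      simp [mem_conductorIdeal]
    simp only [this, top_mem_localizingSystem, zero_mem]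
  -- Stability enters only through this intersection with `R`.
  have hinf : coeSubmodule K (conductorIdeal I x) = x⁻¹ • I ⊓ coeSubmodule K ⊤ := by
    ext y
    simp only [mem_coeSubmodule, Submodule.mem_inf, Submodule.mem_top, true_and,
      ← SetLike.mem_coe (p := x⁻¹ • I), Submodule.coe_pointwise_smul,
      Set.mem_inv_smul_set_iff₀ hx, mem_conductorIdeal]
    constructor
    · rintro ⟨r, hr, rfl⟩
      exact ⟨by simpa [Algebra.smul_def, mul_comm] using hr, r, rfl⟩
    · rintro ⟨hy, r, rfl⟩
      exact ⟨r, by simpa [Algebra.smul_def, mul_comm] using hy, rfl⟩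
  have htop : (1 : K) ∈ s.star (coeSubmodule K ⊤) := top_mem_localizingSystem
  change _ ↔ (1 : K) ∈ s.star _
  rw [hinf, hs, s.star_smul, Submodule.mem_inf, and_iff_left htop,
    ← SetLike.mem_coe (p := x⁻¹ • s.star I), Submodule.coe_pointwise_smul,
    Set.mem_inv_smul_set_iff₀ hx, smul_eq_mul, mul_one, SetLike.mem_coe]

end SemistarOperation

theorem mainTheorem10 {R K : Type*} [CommRing R] [IsDomain R] [Field K] [Algebra R K]
    [IsFractionRing R K]
    (hR : IsPruferDomain R)
    (hSpec : TopologicalSpace.NoetherianSpace (PrimeSpectrum R))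
    (hprinc : ∀ P : PrimeSpectrum R,
      (P.asIdeal.map (algebraMap R (Localization.AtPrime P.asIdeal))).IsPrincipal)
    (s : SemistarOperation R K) (hs : s.IsStable) :
    s.IsSpectral := by
  refine ⟨{P | P.asIdeal ∉ s.localizingSystem}, fun I => ?_⟩
  ext x
  simp only [Submodule.mem_iInf, Set.mem_ofPred_eq, mem_localizeAt_iff, hs.mem_star_iff]
  constructor
  · exact fun h P hP hle => hP (SemistarOperation.mem_localizingSystem_of_le h hle)
  · intro h
    obtain ⟨n, hn⟩ := hR.exists_prod_pow_minimalPrimes_le hprinc (conductorIdeal I x)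
    refine SemistarOperation.mem_localizingSystem_of_le
      (SemistarOperation.prod_pow_mem_localizingSystem _ n fun P hP => ?_) hn
    rw [Set.Finite.mem_toFinset] at hP
    by_contra hPs
    exact h ⟨P, hP.1.1⟩ hPs hP.1.2
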